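/- A \emph{tableau} is a Young diagram (French convention, longest row at the bottom) filled with letters from $\{1,2,3,\dots\}$; its word is read row by row from the top row to the bottom row, each row from left to right. It is \emph{semistandard} if rows are nondecreasing from left to right and columns strictly increase from bottom to top; its evaluation $ev(T)=(ev_1,ev_2,\dots)$ records the number $ev_a$ of occurrences of each letter $a$; it is \emph{standard} if it is semistandard of evaluation $(1,1,\dots,1)$. Let $\sigma_a$ be the operator that modifies, inside the word of a tableau (the shape and all other letters are kept), the subword on the letters $a$ and $b=a+1$ by the rules $$aab\leftrightarrow abb,\qquad aba\leftrightarrow bba,\qquad baa\leftrightarrow bab ;$$ it is used only when $(ev_a,ev_{a+1})\in\{(1,2),(2,1)\}$. Let $\tau_1$ add $1$ to every letter, and let $r_{(11\to 01)}$ replace the subword $11$ formed by the two letters $1$ by $01$. For a semistandard tableau $T$ of evaluation $(ev_1,\dots,ev_k)$ with all $ev_i\in\{1,2\}$, the standardization $VS(T)$ is the standard tableau obtained by repeating the following step until no letter occurs twice: if $i$ is the smallest letter with $ev_i=2$, replace $T$ by $\tau_1\, r_{(11\to 01)}\,\sigma_1\sigma_2\cdots\sigma_{i-1}T$ (the operator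 $\sigma_{i-1}$ acts first). For a tableau $T$ let $A_{a,a}T$ be the formal sum of all tableaux obtained from $T$ by adding a horizontal $2$-strip (two new cells in distinct columns, the result again having a partition shape) whose two cells contain the letter $a$. Let $\mathbb B_2^{(0)}$ be the linear operator on formal $\mathbb Q$-linear combinations of standard tableaux such that, for a standard tableau $\mathcal T$ with $n$ cells, $$\mathbb B_2^{(0)}\mathcal T = VS\bigl(A_{n+1,n+1}\mathcal T\bigr),$$ where $VS$ is extended linearly. For a partition $\lambda$ with at most two parts, put $$\mathbb H_\lambda=\sum_{T\,;\; ev(T)=\lambda'}VS(T),$$ the sum being over all semistandard tableaux $T$ whose evaluation is the conjugate partition $\lambda'$. Then for every partition $\lambda=(\lambda_1,\lambda_2)$ with $\ell(\lambda)\le 2$ (parts may be $0$), $$\mathbb B_2^{(0)}\,\mathbb H_\lambda=\mathbb H_{\lambda+1^2},\qquad \lambda+1^2=(\lambda_1+1,\lambda_2+1).$$ -/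

import Mathlib

namespace TableauOp

/-! ### Partitions

Partitions are Young diagrams: the cell `(i, j)` lies in row `i` and column `j`, counted from `0`.
In the French convention row `0` is the bottom row of the picture. -/

/-- The number of parts `ℓ(lam)`. -/
def numParts (lam : YoungDiagram) : ℕ := lam.colLen 0

/-- The partition `lam + 1^k`, for a partition `lam` with at most `k` parts: each of the first `k`
parts is increased by one. -/
def addOnes (lam : YoungDiagram) (k : ℕ) : YoungDiagram where
  cells := (Finset.range k ×ˢ Finset.range (lam.rowLen 0 + 1)).filter
    fun c => c.2 < lam.rowLen c.1 + 1
  isLowerSet := by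
    rintro ⟨i, j⟩ ⟨i', j'⟩ ⟨h1, h2⟩ hc
    simp only [Finset.coe_filter, Finset.mem_product, Finset.mem_range, Set.mem_ofPred_eq] at *
    have := lam.rowLen_anti i' i h1
    have := lam.rowLen_anti 0 i' (Nat.zero_le _)
    omega

theorem rowLen_addOnes (lam : YoungDiagram) (k : ℕ) (h : numParts lam ≤ k) (i : ℕ) :
    (addOnes lam k).rowLen i = lam.rowLen i + if i < k then 1 else 0 := by
  have hm : ∀ j, j < (addOnes lam k).rowLen i ↔ i < k ∧ j < lam.rowLen i + 1 := by
    intro j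
    rw [← YoungDiagram.mem_iff_lt_rowLen, ← YoungDiagram.mem_cells]
    simp only [addOnes, Finset.mem_filter, Finset.mem_product, Finset.mem_range]
    have := lam.rowLen_anti 0 i (Nat.zero_le _)
    omega
  split_ifs with hi
  · refine eq_of_forall_lt_iff fun j => ?_
    rw [hm]; simp [hi]
  · have h0 : lam.rowLen i = 0 := by
      by_contra hne
      have : (i, 0) ∈ lam := YoungDiagram.mem_iff_lt_rowLen.2 (Nat.pos_of_ne_zero hne)
      have := YoungDiagram.mem_iff_lt_colLen.1 this
      unfold numParts at h
      omega
    rw [h0]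
    refine eq_of_forall_lt_iff fun j => ?_
    rw [hm]; simp [hi]

/-! ### Tableaux -/

/-- A tableau: a Young diagram filled with letters. The entry function is normalised to be `0`
outside of the diagram. -/
@[ext]
structure Tableau where
  shape : YoungDiagram
  entry : ℕ × ℕ → ℕ
  entry_eq_zero : ∀ c, c ∉ shape → entry c = 0

/-- The order in which the word of a tableau is read: row by row from the top row (largest row
index) to the bottom row, and from left to right in each row. -/
def ReadBefore (c d : ℕ × ℕ) : Prop := d.1 < c.1 ∨ (c.1 = d.1 ∧ c.2 ≤ d.2)

instance : DecidableRel ReadBefore := fun c d => by unfold ReadBefore; infer_instance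

instance : IsTrans (ℕ × ℕ) ReadBefore := ⟨by unfold ReadBefore; intro a b c; omega⟩

instance : Std.Antisymm ReadBefore :=
  ⟨by unfold ReadBefore; intro a b h1 h2; ext <;> omega⟩

instance : Std.Total ReadBefore := ⟨by unfold ReadBefore; intro a b; omega⟩

namespace Tableau

/-- The degree, i.e. the number of cells. -/
def degree (T : Tableau) : ℕ := T.shape.card

/-- `T.ev a` is the number of occurrences of the letter `a` in `T`. -/
def ev (T : Tableau) (a : ℕ) : ℕ := (T.shape.cells.filter fun c => T.entry c = a).card

/-- `T` is semistandard over the alphabet `{1, 2, 3, …}`: rows are nondecreasing, columns are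
increasing (away from row `0`), and all letters are positive. -/
def IsSemistandard (T : Tableau) : Prop :=
  (∃ S : SemistandardYoungTableau T.shape, ∀ i j, S i j = T.entry (i, j)) ∧
    ∀ c ∈ T.shape, 0 < T.entry c

/-- The cells of `T` with letters in `s`, in reading order. -/
def subcells (T : Tableau) (s : Finset ℕ) : List (ℕ × ℕ) :=
  (T.shape.cells.filter fun c => T.entry c ∈ s).sort ReadBefore

/-- The restriction of the word of `T` to the alphabet `s`. -/
def subword (T : Tableau) (s : Finset ℕ) : List ℕ := (T.subcells s).map T.entry

/-- Replace the subword of `T` on the alphabet `s` by its image under `g` (a length preserving map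
of words), leaving all other letters in place. -/
def mapSubword (T : Tableau) (s : Finset ℕ) (g : List ℕ → List ℕ) : Tableau where
  shape := T.shape
  entry c := if c ∈ T.subcells s then (g (T.subword s)).getD ((T.subcells s).idxOf c) 0
    else T.entry c
  entry_eq_zero c hc := by
    have h : c ∉ T.subcells s := by
      simp only [subcells, Finset.mem_sort, Finset.mem_filter, YoungDiagram.mem_cells]
      exact fun h => hc h.1
    simp [h, T.entry_eq_zero c hc]

/-- The rules `aab ↔ abb`, `aba ↔ bba`, `baa ↔ bab` on words with three letters. -/
def sigmaRule (a b : ℕ) (v : List ℕ) : List ℕ :=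
  if v = [a, a, b] then [a, b, b] else if v = [a, b, b] then [a, a, b]
  else if v = [a, b, a] then [b, b, a] else if v = [b, b, a] then [a, b, a]
  else if v = [b, a, a] then [b, a, b] else if v = [b, a, b] then [b, a, a]
  else v

/-- The operator `σ_a`. It is only used when the evaluation of `T` in the letters `a, a + 1` is
`(1, 2)` or `(2, 1)`; in all other cases it does nothing here. -/
def sigma (a : ℕ) (T : Tableau) : Tableau := T.mapSubword {a, a + 1} (sigmaRule a (a + 1))

/-- `σ_1 σ_2 ⋯ σ_k`, with `σ_k` acting first. -/
def sigmaProd : ℕ → Tableau → Tableau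
  | 0, T => T
  | k + 1, T => sigmaProd k (sigma (k + 1) T)

/-- The operator `r_{ab → cd}`, which replaces the subword `ab` on the alphabet `{a, b}` by `cd`. -/
def replacePair (a b c d : ℕ) (T : Tableau) : Tableau :=
  T.mapSubword {a, b} fun v => if v = [a, b] then [c, d] else v

/-- The translation `τ_k`, which adds `k` to every letter. -/
def translate (k : ℕ) (T : Tableau) : Tableau where
  shape := T.shape
  entry c := if c ∈ T.shape then T.entry c + k else 0
  entry_eq_zero c hc := by simp [hc]

/-- The letters that occur exactly twice in `T`. -/
def doubled (T : Tableau) : Finset ℕ :=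
  (T.shape.cells.image T.entry).filter fun a => T.ev a = 2

/-- One round of the standardization: if `i` is the smallest letter that occurs twice, apply
`τ_1 r_{11 → 01} σ_1 ⋯ σ_{i-1}`; if there is no such letter, do nothing. -/
def vsRound (T : Tableau) : Tableau :=
  if h : T.doubled.Nonempty then
    translate 1 (replacePair 1 1 0 1 (sigmaProd (T.doubled.min' h - 1) T))
  else T

/-- The standardization `VS` of a semistandard tableau of evaluation `(ev_1, …, ev_k)` with
`ev_i ∈ {1, 2}`. Each round splits one of the letters that occur twice, so that the number of
rounds is the number of these letters. -/
def VS (T : Tableau) : Tableau := vsRound^[T.doubled.card] T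

/-- The tableau of shape `μ` (which contains the shape of `T`) that agrees with `T` on the cells of
`T` and has the letter `a` in all other cells of `μ`. -/
def extend (T : Tableau) (μ : YoungDiagram) (a : ℕ) : Tableau where
  shape := μ
  entry c := if c ∈ μ then (if c ∈ T.shape then T.entry c else a) else 0
  entry_eq_zero c hc := by simp [hc]

end Tableau

/-! ### Finiteness -/

theorem mem_range_of_mem {μ : YoungDiagram} {N : ℕ} (h : μ.card ≤ N) {c : ℕ × ℕ} (hc : c ∈ μ) :
    c ∈ Finset.range N ×ˢ Finset.range N := by
  obtain ⟨i, j⟩ := c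
  have h1 := YoungDiagram.mem_iff_lt_rowLen.1 hc
  have h2 := YoungDiagram.mem_iff_lt_colLen.1 hc
  rw [YoungDiagram.rowLen_eq_card] at h1
  rw [YoungDiagram.colLen_eq_card] at h2
  have h3 : (μ.row i).card ≤ μ.card := Finset.card_le_card (Finset.filter_subset _ _)
  have h4 : (μ.col j).card ≤ μ.card := Finset.card_le_card (Finset.filter_subset _ _)
  simp only [Finset.mem_product, Finset.mem_range]
  omega

/-- `μ` is obtained from `lam` by adding a horizontal 2-strip: two cells in distinct columns. -/
def IsHorizontalTwoStrip (lam μ : YoungDiagram) : Prop :=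
  lam ≤ μ ∧ μ.card = lam.card + 2 ∧
    ∀ c ∈ μ.cells \ lam.cells, ∀ d ∈ μ.cells \ lam.cells, c.2 = d.2 → c = d

theorem finite_horizontalTwoStrips (lam : YoungDiagram) :
    {μ | IsHorizontalTwoStrip lam μ}.Finite := by
  set N := lam.card + 2
  refine Set.Finite.of_finite_image (f := YoungDiagram.cells)
    ((Finset.finite_toSet (Finset.range N ×ˢ Finset.range N).powerset).subset ?_) ?_
  · rintro _ ⟨μ, hμ, rfl⟩
    simp only [Finset.coe_powerset, Set.mem_preimage, Set.mem_powerset_iff, Finset.coe_subset]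
    exact fun c hc => mem_range_of_mem hμ.2.1.le hc
  · intro μ _ ν _ h
    exact YoungDiagram.ext h

theorem finite_tableaux (N M : ℕ) :
    {T : Tableau | T.shape.card ≤ N ∧ ∀ c ∈ T.shape, T.entry c ≤ M}.Finite := by
  refine Set.Finite.of_finite_image (f := fun T => T.shape.cells.image fun c => (c, T.entry c))
    ((Finset.finite_toSet ((Finset.range N ×ˢ Finset.range N) ×ˢ
      Finset.range (M + 1)).powerset).subset ?_) ?_
  · rintro _ ⟨T, ⟨hN, hM⟩, rfl⟩
    simp only [Finset.coe_powerset, Set.mem_preimage, Set.mem_powerset_iff, Finset.coe_subset]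
    intro x hx
    obtain ⟨c, hc, rfl⟩ := Finset.mem_image.1 hx
    exact Finset.mem_product.2
      ⟨mem_range_of_mem hN hc, Finset.mem_range.2 (Nat.lt_succ_of_le (hM c hc))⟩
  · intro T _ U _ h
    have key : ∀ c x, (c ∈ T.shape ∧ T.entry c = x) ↔ (c ∈ U.shape ∧ U.entry c = x) := by
      intro c x
      have hg : ∀ V : Tableau, (c, x) ∈ V.shape.cells.image (fun c => (c, V.entry c)) ↔
          c ∈ V.shape ∧ V.entry c = x := by
        intro V
        simp only [Finset.mem_image, Prod.mk.injEq, YoungDiagram.mem_cells]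
        exact ⟨by rintro ⟨d, hd, rfl, hx⟩; exact ⟨hd, hx⟩, fun hd => ⟨c, hd.1, rfl, hd.2⟩⟩
      rw [← hg T, ← hg U]
      exact Finset.ext_iff.1 h (c, x)
    have hs : ∀ c, c ∈ T.shape ↔ c ∈ U.shape := fun c =>
      ⟨fun hc => ((key c _).1 ⟨hc, rfl⟩).1, fun hc => ((key c _).2 ⟨hc, rfl⟩).1⟩
    refine Tableau.ext (YoungDiagram.ext (Finset.ext hs)) (funext fun c => ?_)
    by_cases hc : c ∈ T.shape
    · exact ((key c _).1 ⟨hc, rfl⟩).2.symm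
    · rw [T.entry_eq_zero c hc, U.entry_eq_zero c fun h => hc ((hs c).2 h)]

/-- The semistandard tableaux of evaluation `lam'`, the conjugate of `lam`: the letter `i + 1`
occurs `lam'_{i+1}` times. -/
def conjTableaux (lam : YoungDiagram) : Set Tableau :=
  {T | T.IsSemistandard ∧ ∀ i, T.ev (i + 1) = lam.transpose.rowLen i}

theorem finite_conjTableaux (lam : YoungDiagram) : (conjTableaux lam).Finite := by
  set M := lam.rowLen 0
  refine (finite_tableaux (∑ a ∈ Finset.range (M + 1), lam.transpose.rowLen (a - 1)) M).subset ?_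
  rintro T ⟨⟨-, hpos⟩, hev⟩
  have hM : ∀ c ∈ T.shape, T.entry c ≤ M := by
    intro c hc
    have h1 : 0 < T.ev (T.entry c - 1 + 1) := by
      rw [Nat.sub_add_cancel (hpos c hc)]
      exact Finset.card_pos.2 ⟨c, by simpa using hc⟩
    rw [hev, YoungDiagram.rowLen_transpose, ← YoungDiagram.mem_iff_lt_colLen,
      YoungDiagram.mem_iff_lt_rowLen] at h1
    change _ < M at h1
    omega
  refine ⟨?_, hM⟩
  have h := Finset.card_eq_sum_card_fiberwise (s := T.shape.cells) (f := T.entry)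
    (t := Finset.range (M + 1)) fun c hc => by
      simpa using Nat.lt_succ_of_le (hM c hc)
  refine h.le.trans (Finset.sum_le_sum fun a _ => ?_)
  rcases Nat.eq_zero_or_pos a with rfl | ha
  · rw [Finset.card_eq_zero.2]
    · exact Nat.zero_le _
    · exact Finset.filter_eq_empty_iff.2 fun c hc => (hpos c hc).ne'
  · rw [← hev, Nat.sub_add_cancel ha]
    exact le_rfl

/-! ### Formal sums of tableaux and operators -/

/-- Formal linear combinations of tableaux. -/
abbrev TableauSum := Tableau →₀ ℚ

/-- The operator `A_{a,a}` on a tableau: the sum of all the tableaux that arise by adding a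
horizontal 2-strip filled with the letter `a`. -/
noncomputable def addStrip (a : ℕ) (T : Tableau) : TableauSum :=
  ∑ μ ∈ (finite_horizontalTwoStrips T.shape).toFinset, Finsupp.single (T.extend μ a) 1

/-- The linear extension of `VS`. -/
noncomputable def VSLin : TableauSum →ₗ[ℚ] TableauSum := Finsupp.lmapDomain ℚ ℚ Tableau.VS

/-- The operator `𝔹₂^{(0)}`: the linear operator that sends a standard tableau `T` of degree `n` to
`VS (A_{n+1,n+1} T)`. -/
noncomputable def B0 : TableauSum →ₗ[ℚ] TableauSum :=
  Finsupp.linearCombination ℚ fun T => VSLin (addStrip (T.degree + 1) T)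

/-- `ℍ_lam`, the sum of the standardizations of all semistandard tableaux of evaluation `lam'`. -/
noncomputable def H (lam : YoungDiagram) : TableauSum :=
  ∑ T ∈ (finite_conjTableaux lam).toFinset, Finsupp.single T.VS 1

end TableauOp

/-! Write λ = (m+k, m), so that λ' = (2^m, 1^k) and (λ+1^2)' = (2^(m+1), 1^k). Adding a horizontal
2-strip of letters m+k+1 to a semistandard tableau of evaluation (2^m, 1^k) gives each semistandard
tableau of evaluation (2^m, 1^k, 2) exactly once: the strip is recovered as the set of cells with
the largest letter. The operators σ_{m+k}, …, σ_{m+1}, in this order, then carry the doubled letter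
leftwards, to evaluation (2^(m+1), 1^k). Each σ_a is an involution and preserves semistandardness
(`isSemistandard_sigma`), so the composite is a bijection between the pairs (T, strip) and the
tableaux indexing the right-hand sum.

The bijection must also match the standardizations (`VS_extend_VS`). A round that splits the letter
i touches only letters up to i before translating. It therefore commutes with adding larger letters
and with σ_a for a > i, except that the translation raises a by 1. After m rounds both sides come
from the same tableau, of evaluation (1^(2m+k), 2): on the left as it stands, on the right after
σ_{2m+1} ⋯ σ_{2m+k}. The last round contributes σ_1 ⋯ σ_{2m+k} on the left and only σ_1 ⋯ σ_{2m} on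
the right, so the total products agree. -/

namespace TableauOp
namespace Tableau

/-! ### Replacing a subword inside a tableau -/

theorem mem_subcells {T : Tableau} {s : Finset ℕ} {c : ℕ × ℕ} :
    c ∈ T.subcells s ↔ c ∈ T.shape ∧ T.entry c ∈ s := by
  simp [subcells]

theorem nodup_subcells (T : Tableau) (s : Finset ℕ) : (T.subcells s).Nodup :=
  Finset.sort_nodup _ _

theorem subcells_congr {T U : Tableau} {s t : Finset ℕ}
    (h : ∀ c, (c ∈ T.shape ∧ T.entry c ∈ s) ↔ (c ∈ U.shape ∧ U.entry c ∈ t)) :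
    T.subcells s = U.subcells t := by
  unfold subcells
  congr 1
  ext c
  simpa using h c

theorem mem_of_mem_subword {T : Tableau} {s : Finset ℕ} {x : ℕ} (hx : x ∈ T.subword s) :
    x ∈ s := by
  obtain ⟨c, hc, rfl⟩ := List.mem_map.1 hx
  exact (mem_subcells.1 hc).2

theorem length_subword (T : Tableau) (s : Finset ℕ) :
    (T.subword s).length = (T.subcells s).length := by simp [subword]

/-- `g` preserves lengths and maps words on `s` to words on `t`. -/
def MapsWords (s t : Finset ℕ) (g : List ℕ → List ℕ) : Prop :=
  ∀ v : List ℕ, (∀ x ∈ v, x ∈ s) → (g v).length = v.length ∧ ∀ x ∈ g v, x ∈ t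

@[simp] theorem shape_mapSubword (T : Tableau) (s : Finset ℕ) (g : List ℕ → List ℕ) :
    (T.mapSubword s g).shape = T.shape := rfl

theorem entry_mapSubword_of_notMem {T : Tableau} {s : Finset ℕ} (g : List ℕ → List ℕ)
    {c : ℕ × ℕ} (hc : T.entry c ∉ s) : (T.mapSubword s g).entry c = T.entry c := by
  simp [mapSubword, mem_subcells, hc]

theorem entry_mapSubword_getElem {T : Tableau} {s : Finset ℕ} (g : List ℕ → List ℕ)
    (n : ℕ) (hn : n < (T.subcells s).length) :
    (T.mapSubword s g).entry (T.subcells s)[n] = (g (T.subword s)).getD n 0 := by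
  simp [mapSubword, (nodup_subcells T s).idxOf_getElem]

theorem entry_mapSubword_mem {T : Tableau} {s t : Finset ℕ} {g : List ℕ → List ℕ}
    (hg : MapsWords s t g) {c : ℕ × ℕ} (hc : c ∈ T.shape) (hs : T.entry c ∈ s) :
    (T.mapSubword s g).entry c ∈ t := by
  obtain ⟨n, hn, rfl⟩ := List.getElem_of_mem (mem_subcells.2 ⟨hc, hs⟩)
  obtain ⟨h1, h2⟩ := hg (T.subword s) fun x => mem_of_mem_subword
  rw [length_subword] at h1
  -- Preservation of length keeps the index in range, so the default value of `getD` never occurs.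
  rw [entry_mapSubword_getElem, List.getD_eq_getElem _ _ (by omega)]
  exact h2 _ (List.getElem_mem _)

theorem subcells_mapSubword_self {T : Tableau} {s : Finset ℕ} {g : List ℕ → List ℕ}
    (hg : MapsWords s s g) : (T.mapSubword s g).subcells s = T.subcells s := by
  refine subcells_congr fun c => and_congr_right fun hc => ?_
  by_cases hs : T.entry c ∈ s
  · exact iff_of_true (entry_mapSubword_mem hg hc hs) hs
  · rw [entry_mapSubword_of_notMem g hs]

theorem subword_mapSubword_self {T : Tableau} {s : Finset ℕ} {g : List ℕ → List ℕ}
    (hg : MapsWords s s g) : (T.mapSubword s g).subword s = g (T.subword s) := by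
  have h1 := (hg (T.subword s) fun x => mem_of_mem_subword).1
  rw [length_subword] at h1
  conv_lhs => rw [subword, subcells_mapSubword_self hg]
  refine List.ext_getElem (by simp [h1]) fun n hn hn' => ?_
  rw [List.getElem_map, entry_mapSubword_getElem, List.getD_eq_getElem _ _ hn']

theorem subcells_mapSubword_of_disjoint {T : Tableau} {s t u : Finset ℕ} {g : List ℕ → List ℕ}
    (hg : MapsWords s t g) (hs : Disjoint s u) (ht : Disjoint t u) :
    (T.mapSubword s g).subcells u = T.subcells u := by
  refine subcells_congr fun c => and_congr_right fun hc => ?_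
  by_cases h : T.entry c ∈ s
  · exact iff_of_false (Finset.disjoint_left.1 ht (entry_mapSubword_mem hg hc h))
      (Finset.disjoint_left.1 hs h)
  · rw [entry_mapSubword_of_notMem g h]

theorem subword_mapSubword_of_disjoint {T : Tableau} {s t u : Finset ℕ} {g : List ℕ → List ℕ}
    (hg : MapsWords s t g) (hs : Disjoint s u) (ht : Disjoint t u) :
    (T.mapSubword s g).subword u = T.subword u := by
  unfold subword
  rw [subcells_mapSubword_of_disjoint hg hs ht]
  refine List.map_congr_left fun c hc => entry_mapSubword_of_notMem g fun h => ?_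
  exact Finset.disjoint_left.1 hs h (mem_subcells.1 hc).2

/-- Neither replacement reads, moves or creates a letter that the other one reads. The target
alphabets need separate hypotheses because splitting 11 creates the new letter 0. -/
theorem mapSubword_comm {T : Tableau} {s s' t t' : Finset ℕ} {g h : List ℕ → List ℕ}
    (hg : MapsWords s s' g) (hh : MapsWords t t' h) (h1 : Disjoint s t) (h2 : Disjoint s' t)
    (h3 : Disjoint t' s) :
    (T.mapSubword s g).mapSubword t h = (T.mapSubword t h).mapSubword s g := by
  refine Tableau.ext rfl (funext fun c => ?_)
  have e1 := subcells_mapSubword_of_disjoint (T := T) hg h1 h2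
  have e2 := subword_mapSubword_of_disjoint (T := T) hg h1 h2
  have e3 := subcells_mapSubword_of_disjoint (T := T) hh h1.symm h3
  have e4 := subword_mapSubword_of_disjoint (T := T) hh h1.symm h3
  have hd : c ∈ T.subcells s → c ∉ T.subcells t := fun hs ht =>
    Finset.disjoint_left.1 h1 (mem_subcells.1 hs).2 (mem_subcells.1 ht).2
  conv_lhs => rw [mapSubword]
  conv_rhs => rw [mapSubword]
  simp only [e1, e2, e3, e4]
  by_cases hs : c ∈ T.subcells s
  · simp [hs, hd hs, mapSubword]
  · by_cases ht : c ∈ T.subcells t <;> simp [hs, ht, mapSubword]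

theorem mapSubword_mapSubword_eq_self {T : Tableau} {s : Finset ℕ} {g : List ℕ → List ℕ}
    (hg : MapsWords s s g) (hgg : ∀ v, g (g v) = v) :
    (T.mapSubword s g).mapSubword s g = T := by
  refine Tableau.ext rfl (funext fun c => ?_)
  by_cases hc : c ∈ T.subcells s
  · rw [mapSubword]
    simp only [subcells_mapSubword_self hg, subword_mapSubword_self hg, hgg, hc, if_true]
    obtain ⟨n, hn, rfl⟩ := List.getElem_of_mem hc
    rw [(nodup_subcells T s).idxOf_getElem]
    simp [subword, hn]
  · have h : c ∉ (T.mapSubword s g).subcells s := by rwa [subcells_mapSubword_self hg]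
    rw [mapSubword]
    simp only [h, if_false]
    simp [hc, mapSubword]

/-! ### Compatibility with translations and extensions -/

theorem subcells_translate (T : Tableau) (k : ℕ) (s t : Finset ℕ)
    (h : ∀ x, x + k ∈ t ↔ x ∈ s) : (T.translate k).subcells t = T.subcells s :=
  subcells_congr fun c => and_congr_right fun hc => by
    have hc' : c ∈ T.shape := hc
    simp [translate, hc', h]

theorem subword_translate (T : Tableau) (k : ℕ) (s t : Finset ℕ)
    (h : ∀ x, x + k ∈ t ↔ x ∈ s) :
    (T.translate k).subword t = (T.subword s).map (· + k) := by
  unfold subword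
  rw [subcells_translate T k s t h, List.map_map]
  refine List.map_congr_left fun c hc => ?_
  simp [translate, (mem_subcells.1 hc).1]

theorem translate_mapSubword (T : Tableau) (k : ℕ) {s t s' : Finset ℕ} {g g' : List ℕ → List ℕ}
    (h : ∀ x, x + k ∈ t ↔ x ∈ s) (hg : MapsWords s s' g)
    (hgg : ∀ v, g' (v.map (· + k)) = (g v).map (· + k)) :
    (T.mapSubword s g).translate k = (T.translate k).mapSubword t g' := by
  refine Tableau.ext rfl (funext fun c => ?_)
  conv_rhs => rw [mapSubword]
  simp only [subcells_translate T k s t h, subword_translate T k s t h, hgg]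
  by_cases hc : c ∈ T.subcells s
  · have hm := (mem_subcells.1 hc).1
    obtain ⟨n, hn, rfl⟩ := List.getElem_of_mem hc
    have h1 := (hg (T.subword s) fun x => mem_of_mem_subword).1
    rw [length_subword] at h1
    simp only [hc, if_true, (nodup_subcells T s).idxOf_getElem]
    have h2 := entry_mapSubword_getElem (T := T) (s := s) g n hn
    rw [List.getD_eq_getElem _ _ (by omega)] at h2
    rw [List.getD_eq_getElem _ _ (by simp; omega), List.getElem_map, ← h2]
    simp [translate, hm]
  · simp [hc, translate, mapSubword]

/-- The added cells all carry `a`, hence are invisible to an alphabet that avoids it; this is why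
operators on small letters ignore the strip. -/
theorem subcells_extend {T : Tableau} {μ : YoungDiagram} (hμ : T.shape ≤ μ) {a : ℕ}
    {s : Finset ℕ} (ha : a ∉ s) : (T.extend μ a).subcells s = T.subcells s := by
  refine subcells_congr fun c => ?_
  by_cases hc : c ∈ T.shape
  · have : c ∈ μ := hμ hc
    simp [extend, hc, this]
  · simp +contextual [extend, hc, ha]

theorem subword_extend {T : Tableau} {μ : YoungDiagram} (hμ : T.shape ≤ μ) {a : ℕ}
    {s : Finset ℕ} (ha : a ∉ s) : (T.extend μ a).subword s = T.subword s := by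
  unfold subword
  rw [subcells_extend hμ ha]
  refine List.map_congr_left fun c hc => ?_
  have hc := (mem_subcells.1 hc).1
  have : c ∈ μ := hμ hc
  simp [extend, hc, this]

theorem mapSubword_extend {T : Tableau} {μ : YoungDiagram} (hμ : T.shape ≤ μ) {a : ℕ}
    {s : Finset ℕ} (ha : a ∉ s) (g : List ℕ → List ℕ) :
    (T.extend μ a).mapSubword s g = (T.mapSubword s g).extend μ a := by
  refine Tableau.ext rfl (funext fun c => ?_)
  conv_lhs => rw [mapSubword]
  simp only [subcells_extend hμ ha, subword_extend hμ ha]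
  by_cases hc : c ∈ T.subcells s
  · have h1 := (mem_subcells.1 hc).1
    have h2 : c ∈ μ := hμ h1
    simp [hc, extend, h1, h2, mapSubword]
  · simp [hc, extend, mapSubword]

theorem translate_extend {T : Tableau} {μ : YoungDiagram} (hμ : T.shape ≤ μ) (a k : ℕ) :
    (T.extend μ a).translate k = (T.translate k).extend μ (a + k) := by
  refine Tableau.ext rfl (funext fun c => ?_)
  by_cases hc : c ∈ T.shape
  · have : c ∈ μ := hμ hc
    simp [translate, extend, hc, this]
  · by_cases h : c ∈ μ <;> simp [translate, extend, hc, h]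

/-! ### The operators `sigma` -/

theorem sigmaRule_involutive {a b : ℕ} (h : a ≠ b) (v : List ℕ) :
    sigmaRule a b (sigmaRule a b v) = v := by
  have h' := h.symm
  by_cases h1 : v = [a, a, b]
  · subst h1; simp [sigmaRule]
  by_cases h2 : v = [a, b, b]
  · subst h2; simp [sigmaRule, h']
  by_cases h3 : v = [a, b, a]
  · subst h3; simp [sigmaRule, h, h']
  by_cases h4 : v = [b, b, a]
  · subst h4; simp [sigmaRule, h, h']
  by_cases h5 : v = [b, a, a]
  · subst h5; simp [sigmaRule, h, h']
  by_cases h6 : v = [b, a, b]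
  · subst h6; simp [sigmaRule, h, h']
  simp [sigmaRule, h1, h2, h3, h4, h5, h6]

theorem mapsWords_sigmaRule (a b : ℕ) : MapsWords {a, b} {a, b} (sigmaRule a b) := by
  intro v hv
  unfold sigmaRule
  split_ifs <;> simp_all

theorem sigmaRule_map_add (a b k : ℕ) (v : List ℕ) :
    sigmaRule (a + k) (b + k) (v.map (· + k)) = (sigmaRule a b v).map (· + k) := by
  have hi : Function.Injective (List.map (· + k)) :=
    List.map_injective_iff.2 (add_left_injective k)
  have h : ∀ w : List ℕ, v.map (· + k) = w.map (· + k) ↔ v = w := fun w => hi.eq_iff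
  have h3 : ∀ x y z : ℕ, [x + k, y + k, z + k] = [x, y, z].map (· + k) := fun _ _ _ => rfl
  unfold sigmaRule
  simp only [h3, h]
  split_ifs <;> rfl

/-- No admissibility is needed: the rules are exchanged in pairs, and every other word is fixed. -/
theorem sigma_involutive (a : ℕ) : Function.Involutive (sigma a) := fun _ =>
  mapSubword_mapSubword_eq_self (mapsWords_sigmaRule _ _) (sigmaRule_involutive (by omega))

@[simp] theorem shape_sigma (a : ℕ) (T : Tableau) : (sigma a T).shape = T.shape := rfl

theorem sigma_comm {a b : ℕ} (h : a + 2 ≤ b) (T : Tableau) :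
    sigma a (sigma b T) = sigma b (sigma a T) := by
  have : Disjoint ({b, b + 1} : Finset ℕ) {a, a + 1} := by
    rw [Finset.disjoint_left]; simp; omega
  exact mapSubword_comm (mapsWords_sigmaRule _ _) (mapsWords_sigmaRule _ _) this this this.symm

theorem translate_sigma (k a : ℕ) (T : Tableau) :
    (sigma a T).translate k = sigma (a + k) (T.translate k) := by
  have h := sigmaRule_map_add a (a + 1) k
  rw [add_right_comm] at h
  exact translate_mapSubword T k (by simp; omega) (mapsWords_sigmaRule _ _) h

theorem sigma_extend {T : Tableau} {μ : YoungDiagram} (hμ : T.shape ≤ μ) {a b : ℕ}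
    (h : a + 1 < b) : sigma a (T.extend μ b) = (sigma a T).extend μ b :=
  mapSubword_extend hμ (by simp; omega) _

theorem mapsWords_split : MapsWords {1, 1} {0, 1}
    fun v => if v = [1, 1] then [0, 1] else v := by
  intro v hv
  dsimp only
  split_ifs with h
  · simp [h]
  · exact ⟨rfl, fun x hx => by simpa using Or.inr (by simpa using hv x hx)⟩

theorem replacePair_sigma {a : ℕ} (h : 2 ≤ a) (T : Tableau) :
    replacePair 1 1 0 1 (sigma a T) = sigma a (replacePair 1 1 0 1 T) := by
  refine mapSubword_comm (mapsWords_sigmaRule _ _) mapsWords_split ?_ ?_ ?_ <;>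
  · rw [Finset.disjoint_left]; simp; try omega

theorem sigmaProd_sigma {n a : ℕ} (h : n + 2 ≤ a) (T : Tableau) :
    sigmaProd n (sigma a T) = sigma a (sigmaProd n T) := by
  induction n generalizing T with
  | zero => rfl
  | succ n ih => rw [sigmaProd, sigmaProd, sigma_comm (by omega), ih (by omega)]

@[simp] theorem shape_sigmaProd (n : ℕ) (T : Tableau) : (sigmaProd n T).shape = T.shape := by
  induction n generalizing T with
  | zero => rfl
  | succ n ih => rw [sigmaProd, ih, shape_sigma]

theorem sigmaProd_extend {T : Tableau} {μ : YoungDiagram} (hμ : T.shape ≤ μ) {n b : ℕ}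
    (h : n + 1 < b) : sigmaProd n (T.extend μ b) = (sigmaProd n T).extend μ b := by
  induction n generalizing T with
  | zero => rfl
  | succ n ih => rw [sigmaProd, sigmaProd, sigma_extend hμ h, ih (T := sigma (n + 1) T) hμ (by omega)]

/-- The product `σ_{m+1} σ_{m+2} ⋯ σ_{m+k}`, with `σ_{m+k}` acting first. -/
def sigmaSeg (m : ℕ) : ℕ → Tableau → Tableau
  | 0, T => T
  | k + 1, T => sigmaSeg m k (sigma (m + k + 1) T)

theorem sigmaProd_sigmaSeg (m k : ℕ) (T : Tableau) :
    sigmaProd m (sigmaSeg m k T) = sigmaProd (m + k) T := by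
  induction k generalizing T with
  | zero => rfl
  | succ k ih => rw [sigmaSeg, ih, ← add_assoc, sigmaProd]

theorem sigmaSeg_injective (m k : ℕ) : Function.Injective (sigmaSeg m k) := by
  induction k with
  | zero => exact fun _ _ h => h
  | succ k ih => exact ih.comp (sigma_involutive _).injective

/-! ### Evaluations -/

theorem count_map_subcells (T : Tableau) (s : Finset ℕ) (f : ℕ × ℕ → ℕ) (x : ℕ) :
    ((T.subcells s).map f).count x
      = (T.shape.cells.filter fun c => T.entry c ∈ s ∧ f c = x).card := by
  rw [← Multiset.coe_count, ← Multiset.map_coe, subcells, Finset.sort_eq, Multiset.count_map,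
    ← Finset.filter_val, Finset.card_val, Finset.filter_filter]
  simp only [eq_comm]

theorem map_entry_mapSubword {T : Tableau} {s t : Finset ℕ} {g : List ℕ → List ℕ}
    (hg : MapsWords s t g) : (T.subcells s).map (T.mapSubword s g).entry = g (T.subword s) := by
  have h1 := (hg (T.subword s) fun x => mem_of_mem_subword).1
  rw [length_subword] at h1
  refine List.ext_getElem (by simp [h1]) fun n hn hn' => ?_
  rw [List.getElem_map, entry_mapSubword_getElem, List.getD_eq_getElem _ _ hn']

theorem ev_eq_count (T : Tableau) {s : Finset ℕ} {x : ℕ} (hx : x ∈ s) :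
    T.ev x = (T.subword s).count x := by
  rw [subword, count_map_subcells, ev]
  congr 1
  exact Finset.filter_congr fun c _ => ⟨fun h => ⟨h ▸ hx, h⟩, fun h => h.2⟩

theorem ev_mapSubword {T : Tableau} {s t : Finset ℕ} {g : List ℕ → List ℕ}
    (hg : MapsWords s t g) (x : ℕ) :
    (T.mapSubword s g).ev x = (g (T.subword s)).count x + if x ∈ s then 0 else T.ev x := by
  rw [← map_entry_mapSubword hg, count_map_subcells, ev,
    ← Finset.card_filter_add_card_filter_not (fun c => T.entry c ∈ s), Finset.filter_filter,
    Finset.filter_filter]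
  congr 1
  · congr 1
    exact Finset.filter_congr fun c _ => and_comm
  · have h : ∀ c ∈ T.shape.cells,
        ((T.mapSubword s g).entry c = x ∧ T.entry c ∉ s ↔ T.entry c = x ∧ x ∉ s) := by
      intro c _
      by_cases hc : T.entry c ∈ s
      · simp only [hc, not_true, and_false, false_iff]
        rintro ⟨rfl, h⟩
        exact h hc
      · rw [entry_mapSubword_of_notMem g hc]
        constructor
        · rintro ⟨rfl, h⟩; exact ⟨rfl, h⟩
        · rintro ⟨rfl, h⟩; exact ⟨rfl, h⟩
    rw [shape_mapSubword, Finset.filter_congr h]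
    split_ifs with hx <;> simp [hx, ev]

/-- These six words are exactly those covered by the rules, so in admissible evaluations `sigmaRule`
never falls through to its identity branch. -/
theorem eq_of_count_eq {a b : ℕ} (hab : a ≠ b) {v : List ℕ} (hv : ∀ x ∈ v, x ∈ ({a, b} : Finset ℕ))
    (h : (v.count a = 1 ∧ v.count b = 2) ∨ (v.count a = 2 ∧ v.count b = 1)) :
    v = [a, a, b] ∨ v = [a, b, b] ∨ v = [a, b, a] ∨ v = [b, b, a] ∨ v = [b, a, a] ∨
      v = [b, a, b] := by
  have hl : ∀ w : List ℕ, (∀ x ∈ w, x ∈ ({a, b} : Finset ℕ)) →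
      w.length = w.count a + w.count b := by
    intro w hw
    induction w with
    | nil => rfl
    | cons x w ih =>
      have := ih fun y hy => hw y (List.mem_cons_of_mem _ hy)
      have hx := hw x List.mem_cons_self
      simp only [Finset.mem_insert, Finset.mem_singleton] at hx
      rcases hx with rfl | rfl
      · simp [hab]; omega
      · simp [hab.symm]; omega
  have h3 : v.length = 3 := by have := hl v hv; omega
  obtain ⟨x, y, z, rfl⟩ := List.length_eq_three.1 h3
  simp only [Finset.mem_insert, Finset.mem_singleton, List.mem_cons, List.not_mem_nil, or_false,
    forall_eq_or_imp, forall_eq] at hv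
  obtain ⟨rfl | rfl, rfl | rfl, rfl | rfl⟩ := hv <;> simp_all [List.count_cons]

/-- The evaluation of `T` in the letters `a`, `a + 1` is `(1, 2)` or `(2, 1)`. -/
def SigmaAdmissible (a : ℕ) (T : Tableau) : Prop :=
  (T.ev a = 1 ∧ T.ev (a + 1) = 2) ∨ (T.ev a = 2 ∧ T.ev (a + 1) = 1)

theorem SigmaAdmissible.subword_cases {a : ℕ} {T : Tableau} (h : SigmaAdmissible a T) :
    T.subword {a, a + 1} = [a, a, a + 1] ∨ T.subword {a, a + 1} = [a, a + 1, a + 1] ∨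
    T.subword {a, a + 1} = [a, a + 1, a] ∨ T.subword {a, a + 1} = [a + 1, a + 1, a] ∨
    T.subword {a, a + 1} = [a + 1, a, a] ∨ T.subword {a, a + 1} = [a + 1, a, a + 1] := by
  refine eq_of_count_eq (by omega) (fun x => mem_of_mem_subword) ?_
  rwa [← ev_eq_count T (by simp), ← ev_eq_count T (by simp)]

theorem ev_sigma_of_ne {a x : ℕ} (h1 : x ≠ a) (h2 : x ≠ a + 1) (T : Tableau) :
    (sigma a T).ev x = T.ev x := by
  have hx : x ∉ ({a, a + 1} : Finset ℕ) := by simp [h1, h2]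
  have := (mapsWords_sigmaRule a (a + 1) (T.subword {a, a + 1}) fun x => mem_of_mem_subword).2
  rw [sigma, ev_mapSubword (mapsWords_sigmaRule a (a + 1)), if_neg hx,
    List.count_eq_zero_of_not_mem fun h => hx (this x h), zero_add]

theorem ev_sigma {a : ℕ} {T : Tableau} (h : SigmaAdmissible a T) :
    (sigma a T).ev a = T.ev (a + 1) ∧ (sigma a T).ev (a + 1) = T.ev a := by
  rw [sigma, ev_mapSubword (mapsWords_sigmaRule a (a + 1)),
    ev_mapSubword (mapsWords_sigmaRule a (a + 1)), if_pos (by simp), if_pos (by simp),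
    ev_eq_count T (s := {a, a + 1}) (x := a) (by simp),
    ev_eq_count T (s := {a, a + 1}) (x := a + 1) (by simp)]
  rcases h.subword_cases with e | e | e | e | e | e <;> rw [e] <;>
    simp [sigmaRule]

/-! ### Effect of one round of standardization -/

/-- The smallest letter that occurs twice in `T` is `i`, and all smaller positive letters occur
exactly once. -/
structure FirstDouble (i : ℕ) (T : Tableau) : Prop where
  pos : 0 < i
  ev_zero : T.ev 0 = 0
  ev_lt : ∀ x, 0 < x → x < i → T.ev x = 1
  ev_self : T.ev i = 2

theorem mem_doubled {T : Tableau} {x : ℕ} : x ∈ T.doubled ↔ T.ev x = 2 := by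
  simp only [doubled, Finset.mem_filter, Finset.mem_image, and_iff_right_iff_imp]
  intro h
  obtain ⟨c, hc⟩ := Finset.card_pos.1 (show 0 < T.ev x by omega)
  rw [Finset.mem_filter] at hc
  exact ⟨c, hc⟩

theorem FirstDouble.vsRound_eq {i : ℕ} {T : Tableau} (h : FirstDouble i T) :
    vsRound T = translate 1 (replacePair 1 1 0 1 (sigmaProd (i - 1) T)) := by
  have hi : i ∈ T.doubled := mem_doubled.2 h.ev_self
  have hne : T.doubled.Nonempty := ⟨i, hi⟩
  have hm : T.doubled.min' hne = i := by
    refine le_antisymm (Finset.min'_le _ _ hi) (Finset.le_min' _ _ _ fun x hx => ?_)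
    rw [mem_doubled] at hx
    by_contra hlt
    rcases Nat.eq_zero_or_pos x with rfl | hx0
    · rw [h.ev_zero] at hx; omega
    · rw [h.ev_lt x hx0 (by omega)] at hx; omega
  rw [vsRound, dif_pos hne, hm]

/-- Each factor exchanges the multiplicities 1 and 2 of two neighbouring letters, so the doubled
letter travels down from n+1 to 1. -/
theorem ev_sigmaProd {n : ℕ} {T : Tableau} (h : ∀ x, 0 < x → x ≤ n → T.ev x = 1)
    (h2 : T.ev (n + 1) = 2) (x : ℕ) : (sigmaProd n T).ev x =
      if x = 1 then 2 else if 0 < x ∧ x ≤ n + 1 then 1 else T.ev x := by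
  induction n generalizing T with
  | zero =>
    rw [sigmaProd]
    split_ifs with h3 h4
    · rw [h3, h2]
    · omega
    · rfl
  | succ n ih =>
    have hn := h (n + 1) (by omega) le_rfl
    obtain ⟨e1, e2⟩ := ev_sigma (Or.inl ⟨hn, h2⟩)
    rw [sigmaProd, ih]
    · split_ifs with h3 h4 h5 h5
      · rfl
      · rfl
      · omega
      · have : x = n + 1 + 1 := by omega
        rw [this, e2, hn]
      · exact ev_sigma_of_ne (by omega) (by omega) T
    · intro x h3 h4
      rw [ev_sigma_of_ne (by omega) (by omega)]
      exact h x h3 (by omega)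
    · rw [e1, h2]

theorem ev_replacePair_split {T : Tableau} (h : T.ev 1 = 2) (x : ℕ) :
    (replacePair 1 1 0 1 T).ev x =
      if x = 1 then 1 else if x = 0 then T.ev 0 + 1 else T.ev x := by
  have hw : T.subword {1, 1} = [1, 1] := by
    have h1 : ∀ y ∈ T.subword {1, 1}, y = 1 := fun y hy => by simpa using mem_of_mem_subword hy
    rw [ev_eq_count T (s := {1, 1}) (by simp), List.count_eq_length.2 fun y hy => (h1 y hy).symm]
      at h
    exact (List.eq_replicate_of_mem h1).trans (by rw [h]; rfl)
  rw [replacePair, ev_mapSubword mapsWords_split, hw]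
  by_cases h1 : x = 1
  · simp [h1]
  · by_cases h0 : x = 0
    · simp [h0, add_comm]
    · simp [h1, h0, Ne.symm h1, Ne.symm h0]

theorem ev_translate_add (T : Tableau) (k x : ℕ) : (T.translate k).ev (x + k) = T.ev x := by
  unfold ev
  congr 1
  refine Finset.filter_congr fun c hc => ?_
  have : c ∈ T.shape := hc
  simp [translate, this]

theorem ev_translate_of_lt (T : Tableau) {k x : ℕ} (h : x < k) : (T.translate k).ev x = 0 := by
  unfold ev
  refine Finset.card_eq_zero.2 (Finset.filter_eq_empty_iff.2 fun c hc => ?_)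
  have : c ∈ T.shape := hc
  simp [translate, this]
  omega

/-- The double is carried to the letter 1, split into 0 and 1, and the alphabet is then shifted: the
initial run of single letters grows from i-1 to i+1. -/
theorem FirstDouble.ev_vsRound {i : ℕ} {T : Tableau} (h : FirstDouble i T) (x : ℕ) :
    (vsRound T).ev x = if x = 0 then 0 else if x ≤ i + 1 then 1 else T.ev (x - 1) := by
  obtain ⟨n, rfl⟩ : ∃ n, i = n + 1 := ⟨i - 1, by have := h.pos; omega⟩
  rw [h.vsRound_eq, Nat.add_sub_cancel]
  have key := ev_sigmaProd (fun x h1 h2 => h.ev_lt x h1 (by omega)) h.ev_self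
  rcases x with _ | x
  · exact ev_translate_of_lt _ one_pos
  · rw [ev_translate_add, ev_replacePair_split (by rw [key, if_pos rfl]), key, key]
    have h0 := h.ev_zero
    simp only [h0]
    split_ifs <;> first | omega | rfl | contradiction

theorem FirstDouble.shape_vsRound {i : ℕ} {T : Tableau} (h : FirstDouble i T) :
    (vsRound T).shape = T.shape := by
  rw [h.vsRound_eq]
  exact shape_sigmaProd _ _

theorem FirstDouble.sigma {i a : ℕ} {T : Tableau} (h : FirstDouble i T) (ha : i < a) :
    FirstDouble i (sigma a T) where
  pos := h.pos
  ev_zero := by rw [ev_sigma_of_ne (by omega) (by omega), h.ev_zero]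
  ev_lt x h1 h2 := by rw [ev_sigma_of_ne (by omega) (by omega), h.ev_lt x h1 h2]
  ev_self := by rw [ev_sigma_of_ne (by omega) (by omega), h.ev_self]

/-- The round uses σ_1, …, σ_{i-1} and the letters 0 and 1, all disjoint from {a, a+1}; only the
final translation changes the index. -/
theorem FirstDouble.vsRound_sigma {i a : ℕ} {T : Tableau} (h : FirstDouble i T) (ha : i < a) :
    vsRound (Tableau.sigma a T) = Tableau.sigma (a + 1) (vsRound T) := by
  have := h.pos
  rw [h.vsRound_eq, (h.sigma ha).vsRound_eq, sigmaProd_sigma (by omega),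
    replacePair_sigma (by omega), translate_sigma]

theorem FirstDouble.vsRound_sigmaSeg {i m : ℕ} {T : Tableau} (h : FirstDouble i T) (hm : i ≤ m)
    (k : ℕ) : vsRound (sigmaSeg m k T) = sigmaSeg (m + 1) k (vsRound T) := by
  induction k generalizing T with
  | zero => rfl
  | succ k ih =>
    rw [sigmaSeg, sigmaSeg, ih (h.sigma (by omega)), h.vsRound_sigma (by omega)]
    congr 2
    omega

theorem ev_extend_of_ne {T : Tableau} {μ : YoungDiagram} (hμ : T.shape ≤ μ) {a x : ℕ}
    (hx : x ≠ a) : (T.extend μ a).ev x = T.ev x := by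
  unfold ev
  congr 1
  ext c
  simp only [Finset.mem_filter, YoungDiagram.mem_cells]
  by_cases hc : c ∈ T.shape
  · have : c ∈ μ := hμ hc
    simp [extend, hc, this]
  · simp +contextual [extend, hc, hx.symm]

theorem ev_extend_self {T : Tableau} {μ : YoungDiagram} (hμ : T.shape ≤ μ) {a : ℕ} :
    (T.extend μ a).ev a = T.ev a + (μ.card - T.shape.card) := by
  have hd : Disjoint (T.shape.cells.filter fun c => T.entry c = a)
      (μ.cells \ T.shape.cells) :=
    Finset.disjoint_sdiff.mono_left (Finset.filter_subset _ _)
  have hs : T.shape.cells ⊆ μ.cells := hμ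
  unfold ev
  rw [YoungDiagram.card, YoungDiagram.card, ← Finset.card_sdiff_of_subset hs,
    ← Finset.card_union_of_disjoint hd]
  congr 1
  ext c
  simp only [Finset.mem_filter, Finset.mem_union, Finset.mem_sdiff, YoungDiagram.mem_cells]
  by_cases hc : c ∈ T.shape
  · have : c ∈ μ := hμ hc
    simp [extend, hc, this]
  · simp +contextual [extend, hc]

theorem FirstDouble.extend {i a : ℕ} {T : Tableau} {μ : YoungDiagram} (h : FirstDouble i T)
    (ha : i < a) (hμ : T.shape ≤ μ) : FirstDouble i (T.extend μ a) where
  pos := h.pos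
  ev_zero := by rw [ev_extend_of_ne hμ (by omega), h.ev_zero]
  ev_lt x h1 h2 := by rw [ev_extend_of_ne hμ (by omega), h.ev_lt x h1 h2]
  ev_self := by rw [ev_extend_of_ne hμ (by omega), h.ev_self]

theorem FirstDouble.vsRound_extend {i a : ℕ} {T : Tableau} {μ : YoungDiagram}
    (h : FirstDouble i T) (ha : i < a) (hμ : T.shape ≤ μ) :
    vsRound (T.extend μ a) = (vsRound T).extend μ (a + 1) := by
  have h1 : (sigmaProd (i - 1) T).shape ≤ μ := by rwa [shape_sigmaProd]
  have := h.pos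
  rw [h.vsRound_eq, (h.extend ha hμ).vsRound_eq, sigmaProd_extend hμ (by omega), replacePair,
    mapSubword_extend h1 (by simp; omega), translate_extend (T := mapSubword _ _ _) h1]
  rfl

/-! ### Iterated rounds -/

/-- The evaluation `(1^s, 2^m, 1^k)`. -/
def blockEv (s m k x : ℕ) : ℕ :=
  if x = 0 then 0 else if x ≤ s then 1 else if x ≤ s + m then 2 else if x ≤ s + m + k then 1 else 0

/-- The evaluation of `T` starts with `(1^s, 2^m)`. -/
def StartsWith (s m : ℕ) (T : Tableau) : Prop := ∀ x ≤ s + m, T.ev x = blockEv s m 0 x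

theorem StartsWith.firstDouble {s m : ℕ} {T : Tableau} (h : StartsWith s (m + 1) T) :
    FirstDouble (s + 1) T where
  pos := s.succ_pos
  ev_zero := h 0 (by omega)
  ev_lt x h1 h2 := by
    rw [h x (by omega), blockEv]
    split_ifs <;> omega
  ev_self := by
    rw [h _ (by omega), blockEv]
    split_ifs <;> omega

theorem StartsWith.vsRound {s m : ℕ} {T : Tableau} (h : StartsWith s (m + 1) T) :
    StartsWith (s + 2) m (vsRound T) := by
  intro x hx
  rw [h.firstDouble.ev_vsRound]
  by_cases hx' : x ≤ s + 2
  · unfold blockEv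
    split_ifs <;> omega
  · rw [h (x - 1) (by omega)]
    unfold blockEv
    split_ifs <;> omega

theorem ev_iterate_vsRound {s m k : ℕ} {T : Tableau} (h : T.ev = blockEv s m k) :
    (vsRound^[m] T).ev = blockEv (s + 2 * m) 0 k := by
  induction m generalizing s T with
  | zero => exact h
  | succ m ih =>
    have h1 : FirstDouble (s + 1) T := StartsWith.firstDouble (m := m) fun x hx => by
      rw [h]
      unfold blockEv
      split_ifs <;> omega
    rw [Function.iterate_succ_apply, ih (s := s + 2)]
    · congr 1; omega
    · funext x
      rw [h1.ev_vsRound, h]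
      unfold blockEv
      split_ifs <;> omega

theorem StartsWith.shape_iterate {s m : ℕ} {T : Tableau} (h : StartsWith s m T) :
    (Tableau.vsRound^[m] T).shape = T.shape := by
  induction m generalizing s T with
  | zero => rfl
  | succ m ih => rw [Function.iterate_succ_apply, ih h.vsRound, h.firstDouble.shape_vsRound]

theorem StartsWith.iterate_sigmaSeg {s m : ℕ} {T : Tableau} (h : StartsWith s m T) (k : ℕ) :
    Tableau.vsRound^[m] (sigmaSeg (s + m) k T)
      = sigmaSeg (s + 2 * m) k (Tableau.vsRound^[m] T) := by
  induction m generalizing s T with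
  | zero => rfl
  | succ m ih =>
    rw [Function.iterate_succ_apply, Function.iterate_succ_apply,
      h.firstDouble.vsRound_sigmaSeg (by omega), show s + (m + 1) + 1 = s + 2 + m by omega,
      ih h.vsRound]
    congr 1
    omega

theorem StartsWith.iterate_extend {s m a : ℕ} {T : Tableau} {μ : YoungDiagram}
    (h : StartsWith s m T) (ha : s + m < a) (hμ : T.shape ≤ μ) :
    Tableau.vsRound^[m] (T.extend μ a) = (Tableau.vsRound^[m] T).extend μ (a + m) := by
  induction m generalizing s a T with
  | zero => rfl
  | succ m ih =>
    rw [Function.iterate_succ_apply, Function.iterate_succ_apply,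
      h.firstDouble.vsRound_extend (by omega) hμ,
      ih h.vsRound (by omega) (by rwa [h.firstDouble.shape_vsRound])]
    congr 1
    omega

theorem VS_of_ev {m k : ℕ} {T : Tableau} (h : T.ev = blockEv 0 m k) :
    T.VS = vsRound^[m] T := by
  have : T.doubled = Finset.Icc 1 m := by
    ext x
    rw [mem_doubled, h, Finset.mem_Icc, blockEv]
    constructor
    · intro hx
      split_ifs at hx <;> omega
    · intro hx
      split_ifs <;> omega
  rw [VS, this, Nat.card_Icc, Nat.add_sub_cancel]

theorem VS_of_firstDouble {i : ℕ} {T : Tableau} (h : FirstDouble i T)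
    (h1 : ∀ x, i < x → T.ev x ≠ 2) : T.VS = vsRound T := by
  have : T.doubled = {i} := by
    ext x
    rw [mem_doubled, Finset.mem_singleton]
    refine ⟨fun hx => ?_, fun hx => hx ▸ h.ev_self⟩
    by_contra hne
    rcases lt_or_gt_of_ne hne with hlt | hlt
    · rcases Nat.eq_zero_or_pos x with rfl | h0
      · rw [h.ev_zero] at hx; omega
      · rw [h.ev_lt x h0 hlt] at hx; omega
    · exact h1 x hlt hx
  rw [VS, this, Finset.card_singleton, Function.iterate_one]

theorem degree_of_ev {n : ℕ} {T : Tableau} (h : T.ev = blockEv n 0 0) : T.degree = n := by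
  have hmem : ∀ c ∈ T.shape.cells, T.entry c ∈ Finset.Icc 1 n := by
    intro c hc
    have : 0 < T.ev (T.entry c) := Finset.card_pos.2 ⟨c, by simpa using hc⟩
    rw [h, blockEv] at this
    rw [Finset.mem_Icc]
    split_ifs at this <;> omega
  rw [degree, YoungDiagram.card, Finset.card_eq_sum_card_fiberwise hmem]
  have : ∀ a ∈ Finset.Icc 1 n, (T.shape.cells.filter fun c => T.entry c = a).card = 1 := by
    intro a ha
    change T.ev a = 1
    rw [Finset.mem_Icc] at ha
    rw [h, blockEv]
    split_ifs <;> omega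
  rw [Finset.sum_congr rfl this]
  simp

/-- Standardizing the small letters first, adding a strip, and standardizing again is the same as
moving the strip to its place with the operators `σ` and then standardizing. -/
theorem VS_extend_VS {m k : ℕ} {T : Tableau} {μ : YoungDiagram} (h : T.ev = blockEv 0 m k)
    (hμ : T.shape ≤ μ) (hc : μ.card = T.shape.card + 2)
    (hev : (sigmaSeg m k (T.extend μ (m + k + 1))).ev = blockEv 0 (m + 1) k) :
    ((T.VS).extend μ (T.VS.degree + 1)).VS = (sigmaSeg m k (T.extend μ (m + k + 1))).VS := by
  have hU : StartsWith 0 m (T.extend μ (m + k + 1)) := fun x hx => by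
    rw [ev_extend_of_ne hμ (by omega), h]
    unfold blockEv
    split_ifs <;> omega
  have hT : StartsWith 0 m T := fun x hx => by
    rw [h]
    unfold blockEv
    split_ifs <;> omega
  have hR := ev_iterate_vsRound h
  have hR' : (vsRound^[m] T).ev = blockEv (2 * m + k) 0 0 := by
    rw [hR]
    funext x
    unfold blockEv
    split_ifs <;> omega
  have hS := hT.shape_iterate
  have hμ' : (vsRound^[m] T).shape ≤ μ := by rwa [hS]
  have hdeg := degree_of_ev hR'
  -- The m translations raise the strip letter m+k+1 to 2m+k+1, which is also the degree of the
  -- standardized tableau plus one.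
  have e0 : vsRound^[m] (T.extend μ (m + k + 1)) = (vsRound^[m] T).extend μ (2 * m + k + 1) := by
    rw [hT.iterate_extend (by omega) hμ]
    congr 1
    omega
  have hF : FirstDouble (2 * m + k + 1) ((vsRound^[m] T).extend μ (2 * m + k + 1)) := by
    refine ⟨by omega, ?_, fun x h1 h2 => ?_, ?_⟩
    · rw [ev_extend_of_ne hμ' (by omega), hR']
      rfl
    · rw [ev_extend_of_ne hμ' (by omega), hR', blockEv]
      split_ifs <;> omega
    · rw [ev_extend_self hμ', hR', hS, hc, blockEv]
      split_ifs <;> omega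
  have e1 : sigmaSeg (2 * m) k ((vsRound^[m] T).extend μ (2 * m + k + 1))
      = vsRound^[m] (sigmaSeg m k (T.extend μ (m + k + 1))) := by
    have := hU.iterate_sigmaSeg k
    rw [zero_add, zero_add, e0] at this
    exact this.symm
  have hV : StartsWith (2 * m) 1 (sigmaSeg (2 * m) k
      ((vsRound^[m] T).extend μ (2 * m + k + 1))) := by
    have h2 : StartsWith 0 (m + 1) (sigmaSeg m k (T.extend μ (m + k + 1))) := fun x hx => by
      rw [hev]
      unfold blockEv
      split_ifs <;> omega
    rw [e1]
    clear * - h2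
    -- Each round trades one doubled letter for two single ones; s is kept general for the
    -- induction.
    have key : ∀ (m s : ℕ) (V : Tableau), StartsWith s (m + 1) V →
        StartsWith (s + 2 * m) 1 (vsRound^[m] V) := by
      intro m
      induction m with
      | zero => intro s V hV; exact hV
      | succ m ih =>
        intro s V hV
        have := ih (s + 2) _ hV.vsRound
        rwa [show s + 2 + 2 * m = s + 2 * (m + 1) by omega] at this
    simpa using key m 0 _ h2
  -- Both sides are now one final round on the same tableau, and `sigmaProd_sigmaSeg` joins σ_1 ⋯
  -- σ_{2m} to σ_{2m+1} ⋯ σ_{2m+k}.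
  rw [VS_of_ev h, hdeg, VS_of_ev hev, Function.iterate_succ_apply', ← e1,
    VS_of_firstDouble hF, hF.vsRound_eq, hV.firstDouble.vsRound_eq, Nat.add_sub_cancel,
    Nat.add_sub_cancel, sigmaProd_sigmaSeg]
  intro x hx
  rw [ev_extend_of_ne hμ' (by omega), hR', blockEv]
  split_ifs <;> omega

/-! ### Semistandard tableaux -/

theorem isSemistandard_iff {T : Tableau} : T.IsSemistandard ↔
    (∀ i j₁ j₂, j₁ < j₂ → (i, j₂) ∈ T.shape → T.entry (i, j₁) ≤ T.entry (i, j₂)) ∧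
    (∀ i₁ i₂ j, i₁ < i₂ → (i₂, j) ∈ T.shape → T.entry (i₁, j) < T.entry (i₂, j)) ∧
    ∀ c ∈ T.shape, 0 < T.entry c := by
  constructor
  · rintro ⟨⟨S, hS⟩, hpos⟩
    refine ⟨fun i j₁ j₂ h hc => ?_, fun i₁ i₂ j h hc => ?_, hpos⟩
    · rw [← hS, ← hS]; exact S.row_weak h hc
    · rw [← hS, ← hS]; exact S.col_strict h hc
  · rintro ⟨h1, h2, h3⟩
    exact ⟨⟨⟨fun i j => T.entry (i, j), fun {i j₁ j₂} => h1 i j₁ j₂, fun {i₁ i₂ j} => h2 i₁ i₂ j,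
      fun {i j} => T.entry_eq_zero (i, j)⟩, fun _ _ => rfl⟩, h3⟩

/-- The entries at the cells `(i, j)` and `(i', j')` satisfy the row and column conditions. -/
def EntryOrdered (f : ℕ × ℕ → ℕ) (i j i' j' : ℕ) : Prop :=
  (i = i' → j < j' → f (i, j) ≤ f (i', j')) ∧ (j = j' → i < i' → f (i, j) < f (i', j'))

theorem EntryOrdered.refl (f : ℕ × ℕ → ℕ) (i j : ℕ) : EntryOrdered f i j i j :=
  ⟨fun _ h => (lt_irrefl _ h).elim, fun _ h => (lt_irrefl _ h).elim⟩

theorem entryOrdered_of_readBefore {f : ℕ × ℕ → ℕ} {r q r' q' : ℕ}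
    (h : r' < r ∨ (r = r' ∧ q < q')) (h1 : r = r' → q < q' → f (r, q) ≤ f (r', q'))
    (h2 : q = q' → r' < r → f (r', q') < f (r, q)) :
    EntryOrdered f r q r' q' ∧ EntryOrdered f r' q' r q :=
  ⟨⟨h1, by omega⟩, by omega, fun e => h2 e.symm⟩

-- Each rule changes a single cell among three, so only order relations between these three cells
-- are at risk. The one real danger is a column with a+1 above a joining the first and third cells
-- read, in the words bba and baa: the rule would make its two entries equal. Such a column would
-- force a fourth cell with letter a or a+1.
set_option maxHeartbeats 400000 in
theorem isSemistandard_sigma {a : ℕ} {T : Tableau} (hT : T.IsSemistandard)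
    (h : SigmaAdmissible a T) : (sigma a T).IsSemistandard := by
  obtain ⟨hrow, hcol, hpos⟩ := isSemistandard_iff.1 hT
  have hlen : (T.subcells {a, a + 1}).length = 3 := by
    rw [← length_subword]
    rcases h.subword_cases with e | e | e | e | e | e <;> simp [e]
  obtain ⟨⟨r₁, q₁⟩, ⟨r₂, q₂⟩, ⟨r₃, q₃⟩, hsub⟩ := List.length_eq_three.1 hlen
  have hnd := nodup_subcells T {a, a + 1}
  have hsort : (T.subcells {a, a + 1}).Pairwise ReadBefore := Finset.pairwise_sort _ _
  have hnew : (T.subcells {a, a + 1}).map (sigma a T).entry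
      = sigmaRule a (a + 1) (T.subword {a, a + 1}) :=
    map_entry_mapSubword (mapsWords_sigmaRule a (a + 1))
  have hmem : ∀ i j, ((i, j) ∈ T.shape ∧ (T.entry (i, j) = a ∨ T.entry (i, j) = a + 1)) ↔
      (i = r₁ ∧ j = q₁) ∨ (i = r₂ ∧ j = q₂) ∨ (i = r₃ ∧ j = q₃) := by
    intro i j
    have : (i, j) ∈ T.subcells {a, a + 1} ↔ _ := mem_subcells
    rw [hsub] at this
    simpa using this.symm
  have hold : T.subword {a, a + 1}
      = [T.entry (r₁, q₁), T.entry (r₂, q₂), T.entry (r₃, q₃)] := by rw [subword, hsub]; rfl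
  rw [hsub] at hnd hsort hnew
  simp only [List.nodup_cons, List.mem_cons, Prod.mk.injEq, List.not_mem_nil, or_false] at hnd
  simp only [List.pairwise_cons, ReadBefore, List.mem_cons, List.not_mem_nil, or_false,
    forall_eq_or_imp, forall_eq] at hsort
  simp only [List.map_cons, List.map_nil] at hnew
  have h₁₂ : r₂ < r₁ ∨ (r₁ = r₂ ∧ q₁ < q₂) := by clear hmem hold; omega
  have h₁₃ : r₃ < r₁ ∨ (r₁ = r₃ ∧ q₁ < q₃) := by clear hmem hold; omega
  have h₂₃ : r₃ < r₂ ∨ (r₂ = r₃ ∧ q₂ < q₃) := by clear hmem hold; omega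
  clear hnd hsort
  have hm₁ := ((hmem r₁ q₁).2 (by simp)).1
  have hm₂ := ((hmem r₂ q₂).2 (by simp)).1
  have hm₃ := ((hmem r₃ q₃).2 (by simp)).1
  have hfix : ∀ c, T.entry c ≠ a → T.entry c ≠ a + 1 → (sigma a T).entry c = T.entry c :=
    fun c h1 h2 => entry_mapSubword_of_notMem _ (by simp [h1, h2])
  have hin : ∀ c ∈ T.shape, (T.entry c = a ∨ T.entry c = a + 1) →
      (sigma a T).entry c = a ∨ (sigma a T).entry c = a + 1 := fun c hc h => by
    simpa [sigma] using
      entry_mapSubword_mem (mapsWords_sigmaRule a (a + 1)) hc (by simpa using h)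
  -- vertically aligned letters `a`, `a + 1` are adjacent
  have hadj : ∀ r r' q, r < r' → (r', q) ∈ T.shape → T.entry (r, q) = a →
      T.entry (r', q) = a + 1 → r' = r + 1 := by
    intro r r' q hlt hm e e'
    by_contra hne
    have h1 := hcol r (r + 1) q (by omega) (T.shape.up_left_mem (by omega) le_rfl hm)
    have h2 := hcol (r + 1) r' q (by omega) hm
    omega
  have hr₁₂ : r₁ = r₂ → q₁ < q₂ → T.entry (r₁, q₁) ≤ T.entry (r₂, q₂) := by
    rintro rfl hq; exact hrow _ _ _ hq hm₂
  have hr₂₃ : r₂ = r₃ → q₂ < q₃ → T.entry (r₂, q₂) ≤ T.entry (r₃, q₃) := by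
    rintro rfl hq; exact hrow _ _ _ hq hm₃
  have hc₁₂ : q₁ = q₂ → r₂ < r₁ → T.entry (r₂, q₂) < T.entry (r₁, q₁) := by
    rintro rfl hr; exact hcol _ _ _ hr hm₁
  have hc₁₃ : q₁ = q₃ → r₃ < r₁ → T.entry (r₃, q₃) < T.entry (r₁, q₁) := by
    rintro rfl hr; exact hcol _ _ _ hr hm₁
  have hc₂₃ : q₂ = q₃ → r₃ < r₂ → T.entry (r₃, q₃) < T.entry (r₂, q₂) := by
    rintro rfl hr; exact hcol _ _ _ hr hm₂
  -- The second b must lie to the right of the first in its row; the cell below it is then at least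
  -- a and less than a+1, a fourth cell of the subword.
  have hbba : T.entry (r₁, q₁) = a + 1 → T.entry (r₂, q₂) = a + 1 → T.entry (r₃, q₃) = a →
      q₁ ≠ q₃ := by
    rintro e₁ e₂ e₃ rfl
    have hr := hadj r₃ r₁ q₁ (by omega) hm₁ e₃ e₁
    obtain rfl : r₂ = r₁ := by omega
    have hx := T.shape.up_left_mem (show r₃ ≤ r₂ by omega) le_rfl hm₂
    have h1 := hcol r₃ r₂ q₂ (by omega) hm₂
    have h2 := hrow r₃ q₁ q₂ (by omega) hx
    have := (hmem r₃ q₂).1 ⟨hx, by omega⟩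
    omega
  -- Dually, the first a lies to the left of the last in its row, and the cell above it is forced to
  -- be a+1.
  have hbaa : T.entry (r₁, q₁) = a + 1 → T.entry (r₂, q₂) = a → T.entry (r₃, q₃) = a →
      q₁ ≠ q₃ := by
    rintro e₁ e₂ e₃ rfl
    have hr := hadj r₃ r₁ q₁ (by omega) hm₁ e₃ e₁
    obtain rfl : r₂ = r₃ := by omega
    have hx := T.shape.up_left_mem le_rfl (show q₂ ≤ q₁ by omega) hm₁
    have h1 := hcol r₂ r₁ q₂ (by omega) hx
    have h2 := hrow r₁ q₂ q₁ (by omega) hm₁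
    have := (hmem r₁ q₂).1 ⟨hx, by omega⟩
    omega
  have hcases := h.subword_cases
  rw [hold] at hcases hnew
  have hnew' : (r₁ = r₂ → q₁ < q₂ → (sigma a T).entry (r₁, q₁) ≤ (sigma a T).entry (r₂, q₂)) ∧
      (r₁ = r₃ → q₁ < q₃ → (sigma a T).entry (r₁, q₁) ≤ (sigma a T).entry (r₃, q₃)) ∧
      (r₂ = r₃ → q₂ < q₃ → (sigma a T).entry (r₂, q₂) ≤ (sigma a T).entry (r₃, q₃)) ∧
      (q₁ = q₂ → r₂ < r₁ → (sigma a T).entry (r₂, q₂) < (sigma a T).entry (r₁, q₁)) ∧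
      (q₁ = q₃ → r₃ < r₁ → (sigma a T).entry (r₃, q₃) < (sigma a T).entry (r₁, q₁)) ∧
      (q₂ = q₃ → r₃ < r₂ → (sigma a T).entry (r₃, q₃) < (sigma a T).entry (r₂, q₂)) := by
    clear hmem hin hfix hadj hrow hcol hpos h hsub hm₁ hm₂ hm₃ hT hold hlen
    rcases hcases with e | e | e | e | e | e <;> rw [e] at hnew <;>
      simp [sigmaRule] at e hnew <;> obtain ⟨e₁, e₂, e₃⟩ := e <;>
      obtain ⟨n₁, n₂, n₃⟩ := hnew <;> rw [n₁, n₂, n₃] <;>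
      simp only [e₁, e₂, e₃, forall_const] at hbba hbaa hr₁₂ hr₂₃ hc₁₂ hc₁₃ hc₂₃ <;>
      clear e₁ e₂ e₃ n₁ n₂ n₃ <;>
      refine ⟨?_, ?_, ?_, ?_, ?_, ?_⟩ <;> omega
  clear hbba hbaa hr₁₂ hr₂₃ hc₁₂ hc₁₃ hc₂₃
  obtain ⟨k₁, k₂, k₃, k₄, k₅, k₆⟩ := hnew'
  obtain ⟨o₁₂, o₂₁⟩ := entryOrdered_of_readBefore h₁₂ k₁ k₄
  obtain ⟨o₁₃, o₃₁⟩ := entryOrdered_of_readBefore h₁₃ k₂ k₅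
  obtain ⟨o₂₃, o₃₂⟩ := entryOrdered_of_readBefore h₂₃ k₃ k₆
  have key : ∀ i j i' j', (i, j) ∈ T.shape → (T.entry (i, j) = a ∨ T.entry (i, j) = a + 1) →
      (i', j') ∈ T.shape → (T.entry (i', j') = a ∨ T.entry (i', j') = a + 1) →
      EntryOrdered (sigma a T).entry i j i' j' := by
    intro i j i' j' h1 h2 h3 h4
    rcases (hmem i j).1 ⟨h1, h2⟩ with ⟨rfl, rfl⟩ | ⟨rfl, rfl⟩ | ⟨rfl, rfl⟩ <;>
    rcases (hmem i' j').1 ⟨h3, h4⟩ with ⟨rfl, rfl⟩ | ⟨rfl, rfl⟩ | ⟨rfl, rfl⟩ <;>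
    first | assumption | exact EntryOrdered.refl _ _ _
  clear hmem hnew hold k₁ k₂ k₃ k₄ k₅ k₆ h₁₂ h₁₃ h₂₃
  have hpos' : ∀ c ∈ T.shape, 0 < (sigma a T).entry c := by
    intro c hc
    by_cases h1 : T.entry c = a ∨ T.entry c = a + 1
    · have : 0 < a := by
        rcases h.subword_cases with e | e | e | e | e | e <;>
        · have hx : a ∈ T.subword {a, a + 1} := by simp [e]
          obtain ⟨d, hd, hda⟩ := List.mem_map.1 hx
          rw [← hda]
          exact hpos d (mem_subcells.1 hd).1
      have := hin c hc h1
      omega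
    · rw [hfix c (by omega) (by omega)]
      exact hpos c hc
  refine isSemistandard_iff.2 ⟨fun i j₁ j₂ hj hc => ?_, fun i₁ i₂ j hi hc => ?_, hpos'⟩
  · have hd : (i, j₁) ∈ T.shape := T.shape.up_left_mem le_rfl hj.le hc
    have h0 := hrow i j₁ j₂ hj hc
    have h1 := hin _ hc
    have h2 := hin _ hd
    have h3 := hfix (i, j₁)
    have h4 := hfix (i, j₂)
    by_cases k1 : T.entry (i, j₁) = a ∨ T.entry (i, j₁) = a + 1
    · by_cases k2 : T.entry (i, j₂) = a ∨ T.entry (i, j₂) = a + 1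
      · exact (key i j₁ i j₂ hd k1 hc k2).1 rfl hj
      · omega
    · omega
  · have hd : (i₁, j) ∈ T.shape := T.shape.up_left_mem hi.le le_rfl hc
    have h0 := hcol i₁ i₂ j hi hc
    have h1 := hin _ hc
    have h2 := hin _ hd
    have h3 := hfix (i₁, j)
    have h4 := hfix (i₂, j)
    by_cases k1 : T.entry (i₁, j) = a ∨ T.entry (i₁, j) = a + 1
    · by_cases k2 : T.entry (i₂, j) = a ∨ T.entry (i₂, j) = a + 1
      · exact (key i₁ j i₂ j hd k1 hc k2).2 rfl hi
      · omega
    · omega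

/-! ### Moving the doubled letter, and adding or removing the strip -/

/-- The evaluation with letters `1, …, m + k + 1`, in which the letters `1, …, m` and `m + j + 1`
occur twice and the others once. -/
def stripEv (m k j x : ℕ) : ℕ :=
  if x = 0 then 0 else if x ≤ m then 2 else if x = m + j + 1 then 2
  else if x ≤ m + k + 1 then 1 else 0

theorem stripEv_zero (m k : ℕ) : stripEv m k 0 = blockEv 0 (m + 1) k := by
  funext x
  unfold stripEv blockEv
  split_ifs <;> omega

theorem sigma_stripEv_succ {m k j : ℕ} (hj : j < k) {T : Tableau}
    (h : T.ev = stripEv m k (j + 1)) :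
    SigmaAdmissible (m + j + 1) T ∧ (sigma (m + j + 1) T).ev = stripEv m k j := by
  have e1 : T.ev (m + j + 1) = 1 := by
    rw [h, stripEv]
    split_ifs <;> omega
  have e2 : T.ev (m + j + 1 + 1) = 2 := by
    rw [h, stripEv]
    split_ifs <;> omega
  obtain ⟨s1, s2⟩ := ev_sigma (Or.inl ⟨e1, e2⟩)
  refine ⟨Or.inl ⟨e1, e2⟩, funext fun x => ?_⟩
  by_cases h1 : x = m + j + 1
  · subst h1
    rw [s1, e2, stripEv]
    split_ifs <;> omega
  by_cases h2 : x = m + j + 1 + 1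
  · subst h2
    rw [s2, e1, stripEv]
    split_ifs <;> omega
  rw [ev_sigma_of_ne h1 h2, h]
  unfold stripEv
  split_ifs <;> omega

theorem sigma_stripEv {m k j : ℕ} (hj : j < k) {T : Tableau} (h : T.ev = stripEv m k j) :
    SigmaAdmissible (m + j + 1) T ∧ (sigma (m + j + 1) T).ev = stripEv m k (j + 1) := by
  have e1 : T.ev (m + j + 1) = 2 := by
    rw [h, stripEv]
    split_ifs <;> omega
  have e2 : T.ev (m + j + 1 + 1) = 1 := by
    rw [h, stripEv]
    split_ifs <;> omega
  obtain ⟨s1, s2⟩ := ev_sigma (Or.inr ⟨e1, e2⟩)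
  refine ⟨Or.inr ⟨e1, e2⟩, funext fun x => ?_⟩
  by_cases h1 : x = m + j + 1
  · subst h1
    rw [s1, e2, stripEv]
    split_ifs <;> omega
  by_cases h2 : x = m + j + 1 + 1
  · subst h2
    rw [s2, e1, stripEv]
    split_ifs <;> omega
  rw [ev_sigma_of_ne h1 h2, h]
  unfold stripEv
  split_ifs <;> omega

theorem sigmaSeg_stripEv {m k j : ℕ} (hj : j ≤ k) {T : Tableau} (hT : T.IsSemistandard)
    (h : T.ev = stripEv m k j) :
    (sigmaSeg m j T).IsSemistandard ∧ (sigmaSeg m j T).ev = stripEv m k 0 := by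
  induction j generalizing T with
  | zero => exact ⟨hT, h⟩
  | succ j ih =>
    obtain ⟨h1, h2⟩ := sigma_stripEv_succ (by omega) h
    exact ih (by omega) (isSemistandard_sigma hT h1) h2

/-- Surjectivity: the involutions are undone one at a time, moving the double back up from m+1 to
m+j+1. -/
theorem exists_sigmaSeg_eq {m k j : ℕ} (hj : j ≤ k) {T : Tableau} (hT : T.IsSemistandard)
    (h : T.ev = stripEv m k 0) :
    ∃ U : Tableau, U.IsSemistandard ∧ U.ev = stripEv m k j ∧ sigmaSeg m j U = T := by
  induction j with
  | zero => exact ⟨T, hT, h, rfl⟩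
  | succ j ih =>
    obtain ⟨U, hU, hev, rfl⟩ := ih (by omega)
    obtain ⟨h1, h2⟩ := sigma_stripEv (by omega) hev
    exact ⟨_, isSemistandard_sigma hU h1, h2, by rw [sigmaSeg, sigma_involutive]⟩

theorem ev_pos {T : Tableau} {c : ℕ × ℕ} (hc : c ∈ T.shape) : 0 < T.ev (T.entry c) :=
  Finset.card_pos.2 ⟨c, by simpa using hc⟩

theorem entry_le_of_blockEv {m k : ℕ} {T : Tableau} (h : T.ev = blockEv 0 m k) {c : ℕ × ℕ}
    (hc : c ∈ T.shape) : T.entry c ≤ m + k := by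
  have := ev_pos hc
  rw [h, blockEv] at this
  split_ifs at this <;> omega

theorem entry_le_of_stripEv {m k : ℕ} {T : Tableau} (h : T.ev = stripEv m k k) {c : ℕ × ℕ}
    (hc : c ∈ T.shape) : T.entry c ≤ m + k + 1 := by
  have := ev_pos hc
  rw [h, stripEv] at this
  split_ifs at this <;> omega

theorem isSemistandard_extend {T : Tableau} {μ : YoungDiagram} {a : ℕ} (hT : T.IsSemistandard)
    (ha : ∀ c ∈ T.shape, T.entry c < a) (ha0 : 0 < a) (hμ : IsHorizontalTwoStrip T.shape μ) :
    (T.extend μ a).IsSemistandard := by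
  obtain ⟨hrow, hcol, hpos⟩ := isSemistandard_iff.1 hT
  have e1 : ∀ c ∈ T.shape, (T.extend μ a).entry c = T.entry c := fun c hc => by
    have : c ∈ μ := hμ.1 hc
    simp [extend, hc, this]
  have e2 : ∀ c ∈ μ, c ∉ T.shape → (T.extend μ a).entry c = a := fun c hc hc' => by
    simp [extend, hc, hc']
  refine isSemistandard_iff.2 ⟨fun i j₁ j₂ hj hc => ?_, fun i₁ i₂ j hi hc => ?_, fun c hc => ?_⟩
  · have hc : (i, j₂) ∈ μ := hc
    have hd : (i, j₁) ∈ μ := μ.up_left_mem le_rfl hj.le hc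
    by_cases h2 : (i, j₂) ∈ T.shape
    · have h1 : (i, j₁) ∈ T.shape := T.shape.up_left_mem le_rfl hj.le h2
      rw [e1 _ h1, e1 _ h2]
      exact hrow _ _ _ hj h2
    · rw [e2 _ hc h2]
      by_cases h1 : (i, j₁) ∈ T.shape
      · rw [e1 _ h1]
        exact (ha _ h1).le
      · rw [e2 _ hd h1]
  · have hc : (i₂, j) ∈ μ := hc
    have hd : (i₁, j) ∈ μ := μ.up_left_mem hi.le le_rfl hc
    by_cases h2 : (i₂, j) ∈ T.shape
    · have h1 : (i₁, j) ∈ T.shape := T.shape.up_left_mem hi.le le_rfl h2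
      rw [e1 _ h1, e1 _ h2]
      exact hcol _ _ _ hi h2
    · rw [e2 _ hc h2]
      by_cases h1 : (i₁, j) ∈ T.shape
      · rw [e1 _ h1]
        exact ha _ h1
      · have := hμ.2.2 (i₁, j) (by simp [hd, h1]) (i₂, j) (by simp [hc, h2]) rfl
        rw [Prod.mk.injEq] at this
        omega
  · by_cases h : c ∈ T.shape
    · rw [e1 c h]
      exact hpos c h
    · rw [e2 c hc h]
      exact ha0

theorem ev_extend_stripEv {m k : ℕ} {T : Tableau} {μ : YoungDiagram} (h : T.ev = blockEv 0 m k)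
    (hμ : IsHorizontalTwoStrip T.shape μ) : (T.extend μ (m + k + 1)).ev = stripEv m k k := by
  funext x
  by_cases hx : x = m + k + 1
  · rw [hx, ev_extend_self hμ.1, h, hμ.2.1]
    unfold blockEv stripEv
    split_ifs <;> first | omega | contradiction
  · rw [ev_extend_of_ne hμ.1 hx, h]
    unfold blockEv stripEv
    split_ifs <;> omega

theorem extend_inj {T U : Tableau} {μ ν : YoungDiagram} {a : ℕ} (hT : T.shape ≤ μ)
    (hU : U.shape ≤ ν) (haT : ∀ c ∈ T.shape, T.entry c < a) (haU : ∀ c ∈ U.shape, U.entry c < a)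
    (h : T.extend μ a = U.extend ν a) : T = U ∧ μ = ν := by
  obtain rfl : μ = ν := congrArg shape h
  refine ⟨?_, rfl⟩
  have key : ∀ c ∈ μ, (if c ∈ T.shape then T.entry c else a)
      = if c ∈ U.shape then U.entry c else a := fun c hc => by
    simpa [extend, hc] using congrFun (congrArg entry h) c
  have hs : ∀ c, c ∈ T.shape ↔ c ∈ U.shape := by
    intro c
    constructor <;> intro hc <;> by_contra hc'
    · have := key c (hT hc)
      rw [if_pos hc, if_neg hc'] at this
      exact (haT c hc).ne this
    · have := key c (hU hc)
      rw [if_neg hc', if_pos hc] at this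
      exact (haU c hc).ne' this
  refine Tableau.ext (YoungDiagram.ext (Finset.ext hs)) (funext fun c => ?_)
  by_cases hc : c ∈ T.shape
  · have := key c (hT hc)
    rwa [if_pos hc, if_pos ((hs c).1 hc)] at this
  · rw [T.entry_eq_zero c hc, U.entry_eq_zero c fun h => hc ((hs c).2 h)]

/-- Deleting the cells with the largest letter leaves a diagram by monotonicity; the deleted cells
lie in distinct columns because columns are strict. -/
theorem exists_extend_eq {m k : ℕ} {U : Tableau} (hU : U.IsSemistandard)
    (hev : U.ev = stripEv m k k) : ∃ (T : Tableau) (μ : YoungDiagram), T.IsSemistandard ∧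
      T.ev = blockEv 0 m k ∧ IsHorizontalTwoStrip T.shape μ ∧ T.extend μ (m + k + 1) = U := by
  obtain ⟨hrow, hcol, hpos⟩ := isSemistandard_iff.1 hU
  let ν : YoungDiagram :=
    { cells := U.shape.cells.filter fun c => U.entry c ≤ m + k
      isLowerSet := by
        rintro ⟨i, j⟩ ⟨i', j'⟩ ⟨h1, h2⟩ hc
        simp only [Finset.coe_filter, Set.mem_ofPred_eq, YoungDiagram.mem_cells] at hc ⊢
        obtain ⟨hc, hle⟩ := hc
        have hd := U.shape.up_left_mem (show i' ≤ i from h1) le_rfl hc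
        refine ⟨U.shape.up_left_mem h1 h2 hc, ?_⟩
        have r1 : U.entry (i', j') ≤ U.entry (i', j) := by
          rcases (show j' ≤ j from h2).eq_or_lt with rfl | hlt
          · exact le_rfl
          · exact hrow _ _ _ hlt hd
        have r2 : U.entry (i', j) ≤ U.entry (i, j) := by
          rcases (show i' ≤ i from h1).eq_or_lt with rfl | hlt
          · exact le_rfl
          · exact (hcol _ _ _ hlt hc).le
        omega }
  have hν : ∀ c, c ∈ ν ↔ c ∈ U.shape ∧ U.entry c ≤ m + k := fun c => by
    rw [← YoungDiagram.mem_cells]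
    simp [ν]
  let T : Tableau :=
    { shape := ν
      entry := fun c => if c ∈ ν then U.entry c else 0
      entry_eq_zero := fun c hc => if_neg hc }
  have hTe : ∀ c ∈ ν, T.entry c = U.entry c := fun c hc => if_pos hc
  have hle : ν ≤ U.shape := fun c hc => ((hν c).1 hc).1
  have hext : T.extend U.shape (m + k + 1) = U := by
    refine Tableau.ext rfl (funext fun c => ?_)
    by_cases hc : c ∈ U.shape
    · by_cases h : c ∈ ν
      · simp [extend, hc, T, h]
      · have h1 := entry_le_of_stripEv hev hc
        have h2 : ¬ U.entry c ≤ m + k := fun h2 => h ((hν c).2 ⟨hc, h2⟩)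
        simp [extend, hc, T, h]
        omega
    · simp [extend, hc, U.entry_eq_zero c hc]
  have hTlt : T.ev (m + k + 1) = 0 := by
    refine Finset.card_eq_zero.2 (Finset.filter_eq_empty_iff.2 fun c hc => ?_)
    have hc : c ∈ ν := hc
    rw [hTe c hc]
    have := ((hν c).1 hc).2
    omega
  have hTev : T.ev = blockEv 0 m k := by
    funext x
    by_cases hx : x = m + k + 1
    · rw [hx, hTlt, blockEv]
      split_ifs <;> omega
    · rw [← ev_extend_of_ne (T := T) hle hx, hext, hev]
      unfold blockEv stripEv
      split_ifs <;> omega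
  refine ⟨T, U.shape, isSemistandard_iff.2 ⟨fun i j₁ j₂ hj hc => ?_, fun i₁ i₂ j hi hc => ?_,
    fun c hc => ?_⟩, hTev, ⟨hle, ?_, ?_⟩, hext⟩
  · rw [hTe _ hc, hTe _ (ν.up_left_mem le_rfl hj.le hc)]
    exact hrow _ _ _ hj (hle hc)
  · rw [hTe _ hc, hTe _ (ν.up_left_mem hi.le le_rfl hc)]
    exact hcol _ _ _ hi (hle hc)
  · rw [hTe _ hc]
    exact hpos _ (hle hc)
  · have h1 := ev_extend_self (T := T) (μ := U.shape) hle (a := m + k + 1)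
    have h2 : U.ev (m + k + 1) = 2 := by
      rw [hev, stripEv]
      split_ifs <;> omega
    rw [hext, hTlt, h2] at h1
    omega
  · rintro ⟨i, j⟩ hc ⟨i', j'⟩ hd (rfl : j = j')
    have hval : ∀ i, (i, j) ∈ U.shape.cells \ T.shape.cells →
        (i, j) ∈ U.shape ∧ U.entry (i, j) = m + k + 1 := by
      intro i hi
      simp only [Finset.mem_sdiff, YoungDiagram.mem_cells] at hi
      have h1 := entry_le_of_stripEv hev hi.1
      have h2 : ¬ U.entry (i, j) ≤ m + k := fun h2 => hi.2 ((hν _).2 ⟨hi.1, h2⟩)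
      exact ⟨hi.1, by omega⟩
    obtain ⟨m1, v1⟩ := hval i hc
    obtain ⟨m2, v2⟩ := hval i' hd
    rcases lt_trichotomy i i' with h | rfl | h
    · have := hcol _ _ _ h m2
      omega
    · rfl
    · have := hcol _ _ _ h m1
      omega

end Tableau

open Tableau

/-! ### The bijection between the two sums -/

theorem mem_conjTableaux_iff {lam : YoungDiagram} (hlam : numParts lam ≤ 2) {m k : ℕ}
    (h0 : lam.rowLen 0 = m + k) (h1 : lam.rowLen 1 = m) {T : Tableau} :
    T ∈ conjTableaux lam ↔ T.IsSemistandard ∧ T.ev = blockEv 0 m k := by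
  have hc : ∀ i, lam.transpose.rowLen i = blockEv 0 m k (i + 1) := by
    intro i
    rw [YoungDiagram.rowLen_transpose]
    have a0 : 0 < lam.colLen i ↔ i < m + k := by
      rw [← YoungDiagram.mem_iff_lt_colLen, YoungDiagram.mem_iff_lt_rowLen, h0]
    have a1 : 1 < lam.colLen i ↔ i < m := by
      rw [← YoungDiagram.mem_iff_lt_colLen, YoungDiagram.mem_iff_lt_rowLen, h1]
    have a2 : lam.colLen i ≤ 2 := (lam.colLen_anti 0 i (Nat.zero_le _)).trans hlam
    unfold blockEv
    split_ifs <;> first | omega | contradiction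
  refine and_congr_right fun hT => ⟨fun h => funext fun x => ?_, fun h i => by rw [h, hc]⟩
  rcases x with _ | x
  · refine Finset.card_eq_zero.2 (Finset.filter_eq_empty_iff.2 fun c hc => ?_)
    exact (hT.2 c hc).ne'
  · rw [h, hc]

theorem numParts_addOnes_le (lam : YoungDiagram) (k : ℕ) : numParts (addOnes lam k) ≤ k := by
  by_contra hlt
  have : (k, 0) ∈ addOnes lam k := YoungDiagram.mem_iff_lt_colLen.2 (not_le.1 hlt)
  rw [← YoungDiagram.mem_cells] at this
  simp [addOnes] at this

theorem B0_single (T : Tableau) : B0 (Finsupp.single T 1) =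
    ∑ μ ∈ (finite_horizontalTwoStrips T.shape).toFinset,
      Finsupp.single (T.extend μ (T.degree + 1)).VS 1 := by
  simp only [B0, addStrip, VSLin, Finsupp.linearCombination_single, one_smul, map_sum,
    Finsupp.lmapDomain_apply, Finsupp.mapDomain_single]

theorem B0_H {lam : YoungDiagram} (hlam : numParts lam ≤ 2) : B0 (H lam) = H (addOnes lam 2) := by
  obtain ⟨k, h0⟩ := Nat.exists_eq_add_of_le (lam.rowLen_anti 0 1 zero_le_one)
  have hmem := fun T : Tableau => mem_conjTableaux_iff (T := T) hlam h0 rfl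
  set m := lam.rowLen 1 with hm
  have hmem' : ∀ T : Tableau, T ∈ conjTableaux (addOnes lam 2) ↔
      T.IsSemistandard ∧ T.ev = blockEv 0 (m + 1) k := fun T =>
    mem_conjTableaux_iff (numParts_addOnes_le lam 2)
      (by rw [rowLen_addOnes lam 2 hlam, h0]; simp; omega)
      (by rw [rowLen_addOnes lam 2 hlam]; simp [hm])
  -- `B0` adds strips to the shape of `T.VS`, whereas the bijection adds them to `T`; the shapes
  -- agree.
  have hshape : ∀ T ∈ conjTableaux lam, T.VS.shape = T.shape := fun T hT => by
    have hev := ((hmem T).1 hT).2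
    rw [VS_of_ev hev]
    refine StartsWith.shape_iterate (s := 0) fun x hx => ?_
    rw [hev]
    unfold blockEv
    split_ifs <;> omega
  have hlt : ∀ T ∈ conjTableaux lam, ∀ c ∈ T.shape, T.entry c < m + k + 1 := fun T hT c hc =>
    Nat.lt_succ_of_le (entry_le_of_blockEv ((hmem T).1 hT).2 hc)
  have hseg : ∀ T ∈ conjTableaux lam, ∀ μ, IsHorizontalTwoStrip T.shape μ →
      sigmaSeg m k (T.extend μ (m + k + 1)) ∈ conjTableaux (addOnes lam 2) := by
    intro T hT μ hμ
    obtain ⟨hS, hev⟩ := (hmem T).1 hT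
    rw [hmem', ← stripEv_zero]
    exact sigmaSeg_stripEv le_rfl
      (isSemistandard_extend hS (hlt T hT) (Nat.succ_pos _) hμ) (ev_extend_stripEv hev hμ)
  simp only [H, map_sum, B0_single]
  rw [Finset.sum_sigma']
  refine Finset.sum_bij (fun p _ => sigmaSeg m k (p.1.extend p.2 (m + k + 1))) ?_ ?_ ?_ ?_
  · rintro ⟨T, μ⟩ hp
    simp only [Finset.mem_sigma, Set.Finite.mem_toFinset, Set.mem_ofPred_eq] at hp ⊢
    exact hseg T hp.1 μ (hshape T hp.1 ▸ hp.2)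
  · rintro ⟨T, μ⟩ hp ⟨U, ν⟩ hq h
    simp only [Finset.mem_sigma, Set.Finite.mem_toFinset, Set.mem_ofPred_eq] at hp hq
    obtain ⟨rfl, rfl⟩ := extend_inj (hshape T hp.1 ▸ hp.2.1) (hshape U hq.1 ▸ hq.2.1)
      (hlt T hp.1) (hlt U hq.1) (sigmaSeg_injective m k h)
    rfl
  · intro V hV
    rw [Set.Finite.mem_toFinset, hmem', ← stripEv_zero] at hV
    obtain ⟨U, hU, hUev, rfl⟩ := exists_sigmaSeg_eq (le_refl k) hV.1 hV.2
    obtain ⟨T, μ, hT, hTev, hμ, rfl⟩ := exists_extend_eq hU hUev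
    have hT' : T ∈ conjTableaux lam := (hmem T).2 ⟨hT, hTev⟩
    refine ⟨⟨T, μ⟩, ?_, rfl⟩
    simp only [Finset.mem_sigma, Set.Finite.mem_toFinset, Set.mem_ofPred_eq]
    exact ⟨hT', (hshape T hT').symm ▸ hμ⟩
  · rintro ⟨T, μ⟩ hp
    simp only [Finset.mem_sigma, Set.Finite.mem_toFinset, Set.mem_ofPred_eq] at hp
    have hμ : IsHorizontalTwoStrip T.shape μ := hshape T hp.1 ▸ hp.2
    rw [VS_extend_VS ((hmem T).1 hp.1).2 hμ.1 hμ.2.1 ((hmem' _).1 (hseg T hp.1 μ hμ)).2]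

end TableauOp

theorem mainTheorem9 (lam : YoungDiagram) (hlam : TableauOp.numParts lam ≤ 2) :
    TableauOp.B0 (TableauOp.H lam) = TableauOp.H (TableauOp.addOnes lam 2) :=
  TableauOp.B0_H hlam
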